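/- Let $(M,g,J,\kappa)$ be an almost Kähler manifold: $M$ is a smooth manifold, $\kappa$ is a symplectic form on $M$ (a smooth, closed, non-degenerate 2-form), $J$ is a smooth almost complex structure on $M$ (a smooth section of $\mathrm{End}(TM)$ with $J^2=-\mathrm{Id}$), and $J$ is calibrated by $\kappa$, i.e. $g(\cdot,\cdot)=\kappa(\cdot,J\cdot)$ is a Hermitian (positive definite, $J$-invariant) Riemannian metric. Let $\nabla$ be the Levi-Civita connection of $g$, let $$N_J(X,Y)=[JX,JY]-J[JX,Y]-J[X,JY]-[X,Y]$$ be the Nijenhuis tensor of $J$, and extend $\nabla$ and $N_J$ complex (multi)linearly to $TM\otimes\mathbb C=T^{1,0}_JM\oplus T^{0,1}_JM$, where $T^{1,0}_JM$ and $T^{0,1}_JM$ are the eigenspaces of $J$ for $i$ and $-i$. Let $\nabla''_W=\nabla_{W^{0,1}}$ be the $(0,1)$-part of the covariant derivative, $W^{0,1}=\frac12(W+iJW)$ being the projection of $W$ on $T^{0,1}_JM$. If $\nabla''N_J=0$, that is, $$\nabla''_W\big(N_J(X,Y)\big)-N_J(\nabla''_WX,Y)-N_J(X,\nabla''_WY)=0$$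 for every complex tangent vector $W$ and all local smooth complex vector fields $X,Y$, then $N_J=0$, i.e. $J$ is integrable, and hence $(M,g,J,\kappa)$ is a Kähler manifold (an almost Kähler manifold whose $J$ is integrable). -/

import Mathlib

open Bundle
open scoped Manifold ContDiff TensorProduct

noncomputable section

/-- A smooth almost complex structure on the manifold `M`: a smooth section `J` of `End(TM)` with
`J² = -Id`. -/
structure AlmostComplexStructure (E : Type*) [NormedAddCommGroup E] [NormedSpace ℝ E]
    (M : Type*) [TopologicalSpace M] [ChartedSpace E M] [IsManifold 𝓘(ℝ, E) ∞ M] where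
  /-- The endomorphism of each tangent space. -/
  toFun : ∀ x : M, TangentSpace 𝓘(ℝ, E) x →L[ℝ] TangentSpace 𝓘(ℝ, E) x
  smooth : ContMDiff 𝓘(ℝ, E) (𝓘(ℝ, E).prod 𝓘(ℝ, E →L[ℝ] E)) ∞
    (fun x ↦ Bundle.TotalSpace.mk' (E →L[ℝ] E)
      (E := fun x : M ↦ TangentSpace 𝓘(ℝ, E) x →L[ℝ] TangentSpace 𝓘(ℝ, E) x) x (toFun x))
  sq_eq_neg : ∀ (x : M) (v : TangentSpace 𝓘(ℝ, E) x), toFun x (toFun x v) = -v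

/-- The exterior derivative of a 2-form `κ`, evaluated on three vector fields:
`dκ(X,Y,Z) = X κ(Y,Z) - Y κ(X,Z) + Z κ(X,Y) - κ([X,Y],Z) + κ([X,Z],Y) - κ([Y,Z],X)`. -/
def extDerivTwoForm {E : Type*} [NormedAddCommGroup E] [NormedSpace ℝ E]
    {M : Type*} [TopologicalSpace M] [ChartedSpace E M]
    (κ : ∀ x : M, TangentSpace 𝓘(ℝ, E) x →L[ℝ] TangentSpace 𝓘(ℝ, E) x →L[ℝ] ℝ)
    (X Y Z : ∀ x : M, TangentSpace 𝓘(ℝ, E) x) (x : M) : ℝ :=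
  mvfderiv 𝓘(ℝ, E) (fun y ↦ κ y (Y y) (Z y)) x (X x)
    - mvfderiv 𝓘(ℝ, E) (fun y ↦ κ y (X y) (Z y)) x (Y x)
    + mvfderiv 𝓘(ℝ, E) (fun y ↦ κ y (X y) (Y y)) x (Z x)
    - κ x (VectorField.mlieBracket 𝓘(ℝ, E) X Y x) (Z x)
    + κ x (VectorField.mlieBracket 𝓘(ℝ, E) X Z x) (Y x)
    - κ x (VectorField.mlieBracket 𝓘(ℝ, E) Y Z x) (X x)

/-- The vector field `X` is smooth on the set `U`. -/
def SmoothFieldOn {E : Type*} [NormedAddCommGroup E] [NormedSpace ℝ E]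
    {M : Type*} [TopologicalSpace M] [ChartedSpace E M] [IsManifold 𝓘(ℝ, E) ∞ M]
    (X : ∀ x : M, TangentSpace 𝓘(ℝ, E) x) (U : Set M) : Prop :=
  ContMDiffOn 𝓘(ℝ, E) 𝓘(ℝ, E).tangent ∞ (fun x ↦ (X x : TangentBundle 𝓘(ℝ, E) M)) U

/-- A symplectic form on `M`: a smooth, closed, non-degenerate 2-form. -/
structure SymplecticForm (E : Type*) [NormedAddCommGroup E] [NormedSpace ℝ E]
    (M : Type*) [TopologicalSpace M] [ChartedSpace E M] [IsManifold 𝓘(ℝ, E) ∞ M] where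
  /-- The bilinear form on each tangent space. -/
  toFun : ∀ x : M, TangentSpace 𝓘(ℝ, E) x →L[ℝ] TangentSpace 𝓘(ℝ, E) x →L[ℝ] ℝ
  smooth : ContMDiff 𝓘(ℝ, E) (𝓘(ℝ, E).prod 𝓘(ℝ, E →L[ℝ] E →L[ℝ] ℝ)) ∞
    (fun x ↦ Bundle.TotalSpace.mk' (E →L[ℝ] E →L[ℝ] ℝ)
      (E := fun x : M ↦ TangentSpace 𝓘(ℝ, E) x →L[ℝ] TangentSpace 𝓘(ℝ, E) x →L[ℝ] ℝ)
      x (toFun x))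
  alternating : ∀ (x : M) (v : TangentSpace 𝓘(ℝ, E) x), toFun x v v = 0
  nondegenerate : ∀ (x : M) (v : TangentSpace 𝓘(ℝ, E) x), (∀ w, toFun x v w = 0) → v = 0
  closed : ∀ (U : Set M) (X Y Z : ∀ x : M, TangentSpace 𝓘(ℝ, E) x), IsOpen U →
    SmoothFieldOn X U → SmoothFieldOn Y U → SmoothFieldOn Z U →
    ∀ x ∈ U, extDerivTwoForm toFun X Y Z x = 0

namespace AlmostComplexStructure

section Nijenhuis

variable {E : Type*} [NormedAddCommGroup E] [NormedSpace ℝ E]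
  {M : Type*} [TopologicalSpace M] [ChartedSpace E M] [IsManifold 𝓘(ℝ, E) ∞ M]
  (J : AlmostComplexStructure E M)

/-- The vector field `JX`. -/
def onField (X : ∀ x : M, TangentSpace 𝓘(ℝ, E) x) : ∀ x : M, TangentSpace 𝓘(ℝ, E) x :=
  fun x ↦ J.toFun x (X x)

/-- The Nijenhuis expression `[JX,JY] - J[JX,Y] - J[X,JY] - [X,Y]` for vector fields `X`, `Y`. -/
def nijenhuisField (X Y : ∀ x : M, TangentSpace 𝓘(ℝ, E) x) (x : M) : TangentSpace 𝓘(ℝ, E) x :=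
  VectorField.mlieBracket 𝓘(ℝ, E) (J.onField X) (J.onField Y) x
    - J.toFun x (VectorField.mlieBracket 𝓘(ℝ, E) (J.onField X) Y x)
    - J.toFun x (VectorField.mlieBracket 𝓘(ℝ, E) X (J.onField Y) x)
    - VectorField.mlieBracket 𝓘(ℝ, E) X Y x

theorem onField_add (X Y : ∀ x : M, TangentSpace 𝓘(ℝ, E) x) :
    J.onField (X + Y) = J.onField X + J.onField Y := by
  funext x; simp [onField]

theorem onField_smul (f : M → ℝ) (X : ∀ x : M, TangentSpace 𝓘(ℝ, E) x) :
    J.onField (f • X) = f • J.onField X := by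
  funext x; simp [onField]

theorem mdifferentiableAt_onField {X : ∀ x : M, TangentSpace 𝓘(ℝ, E) x} {x : M}
    (hX : MDiffAt (T% X) x) : MDiffAt (T% (J.onField X)) x :=
  MDifferentiableAt.clm_bundle_apply
    ((J.smooth x).mdifferentiableAt (by simp)) hX

theorem nijenhuisField_swap (X Y : ∀ x : M, TangentSpace 𝓘(ℝ, E) x) (x : M) :
    J.nijenhuisField X Y x = - J.nijenhuisField Y X x := by
  simp only [nijenhuisField]
  rw [VectorField.mlieBracket_swap_apply (V := J.onField X) (W := J.onField Y),
    VectorField.mlieBracket_swap_apply (V := J.onField X) (W := Y),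
    VectorField.mlieBracket_swap_apply (V := X) (W := J.onField Y),
    VectorField.mlieBracket_swap_apply (V := X) (W := Y)]
  simp only [map_neg]
  abel

variable [CompleteSpace E]

theorem nijenhuisField_tensorial_left {x : M} {Y : ∀ x : M, TangentSpace 𝓘(ℝ, E) x} :
    TensorialAt 𝓘(ℝ, E) E (fun X ↦ J.nijenhuisField X Y x) x where
  smul {f X} hf hX := by
    have hJX := J.mdifferentiableAt_onField hX
    have h := J.sq_eq_neg x
    simp only [nijenhuisField, onField_smul, VectorField.mlieBracket_smul_left hf hX,
      VectorField.mlieBracket_smul_left hf hJX, map_add, map_smul]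
    simp only [onField, h]
    module
  add {X X'} hX hX' := by
    have hJX := J.mdifferentiableAt_onField hX
    have hJX' := J.mdifferentiableAt_onField hX'
    simp only [nijenhuisField, onField_add, VectorField.mlieBracket_add_left hX hX',
      VectorField.mlieBracket_add_left hJX hJX', map_add]
    abel

theorem nijenhuisField_tensorial_right {x : M} {X : ∀ x : M, TangentSpace 𝓘(ℝ, E) x} :
    TensorialAt 𝓘(ℝ, E) E (fun Y ↦ J.nijenhuisField X Y x) x where
  smul hf hY := by
    simp only [J.nijenhuisField_swap X]
    rw [J.nijenhuisField_tensorial_left.smul hf hY, smul_neg]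
  add hY hY' := by
    simp only [J.nijenhuisField_swap X]
    rw [J.nijenhuisField_tensorial_left.add hY hY', neg_add]

variable [FiniteDimensional ℝ E]

/-- The Nijenhuis tensor `N_J` at the point `x`: the bilinear map with
`N_J(X,Y) = [JX,JY] - J[JX,Y] - J[X,JY] - [X,Y]` for all vector fields `X`, `Y`. -/
def nijenhuis (x : M) :
    TangentSpace 𝓘(ℝ, E) x →L[ℝ] TangentSpace 𝓘(ℝ, E) x →L[ℝ] TangentSpace 𝓘(ℝ, E) x :=
  TensorialAt.mkHom₂ (fun X Y ↦ J.nijenhuisField X Y x) x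
    (fun _ _ ↦ J.nijenhuisField_tensorial_left) (fun _ _ ↦ J.nijenhuisField_tensorial_right)

theorem nijenhuis_apply {x : M} {X Y : ∀ x : M, TangentSpace 𝓘(ℝ, E) x}
    (hX : MDiffAt (T% X) x) (hY : MDiffAt (T% Y) x) :
    J.nijenhuis x (X x) (Y x) = J.nijenhuisField X Y x :=
  TensorialAt.mkHom₂_apply (Φ := fun X Y ↦ J.nijenhuisField X Y x)
    (fun _ _ ↦ J.nijenhuisField_tensorial_left) (fun _ _ ↦ J.nijenhuisField_tensorial_right) hX hY

/-- `J` is integrable: its Nijenhuis tensor vanishes. -/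
def IsIntegrable : Prop := ∀ x : M, J.nijenhuis x = 0

end Nijenhuis

end AlmostComplexStructure

section Complexification

variable {E : Type*} [NormedAddCommGroup E] [NormedSpace ℝ E]
  {M : Type*} [TopologicalSpace M] [ChartedSpace E M]

/-- The complexified tangent space `T_xM ⊗ ℂ`. -/
abbrev ComplexTangentSpace (E : Type*) [NormedAddCommGroup E] [NormedSpace ℝ E]
    {M : Type*} [TopologicalSpace M] [ChartedSpace E M] (x : M) : Type _ :=
  ℂ ⊗[ℝ] TangentSpace 𝓘(ℝ, E) x

/-- The real part `A` of a complex tangent vector `A + iB`. -/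
def rePart (x : M) : ComplexTangentSpace E x →ₗ[ℝ] TangentSpace 𝓘(ℝ, E) x :=
  (TensorProduct.lid ℝ (TangentSpace 𝓘(ℝ, E) x)).toLinearMap ∘ₗ
    LinearMap.rTensor (TangentSpace 𝓘(ℝ, E) x) Complex.reLm

/-- The imaginary part `B` of a complex tangent vector `A + iB`. -/
def imPart (x : M) : ComplexTangentSpace E x →ₗ[ℝ] TangentSpace 𝓘(ℝ, E) x :=
  (TensorProduct.lid ℝ (TangentSpace 𝓘(ℝ, E) x)).toLinearMap ∘ₗ
    LinearMap.rTensor (TangentSpace 𝓘(ℝ, E) x) Complex.imLm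

/-- The real part and the imaginary part of a complex vector field are smooth on `U`. -/
def SmoothComplexFieldOn [IsManifold 𝓘(ℝ, E) ∞ M] (Z : ∀ x : M, ComplexTangentSpace E x)
    (U : Set M) : Prop :=
  SmoothFieldOn (fun x ↦ rePart x (Z x)) U ∧ SmoothFieldOn (fun x ↦ imPart x (Z x)) U

/-- The natural projection `W ↦ W^{0,1} = (W + i J W) / 2` of `T_xM ⊗ ℂ` onto the eigenspace
`T^{0,1}` of `J` for the eigenvalue `-i`. -/
def AlmostComplexStructure.proj01 [IsManifold 𝓘(ℝ, E) ∞ M] (J : AlmostComplexStructure E M)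
    (x : M) : ComplexTangentSpace E x →ₗ[ℂ] ComplexTangentSpace E x :=
  (1 / 2 : ℂ) • (LinearMap.id + Complex.I • (J.toFun x).toLinearMap.baseChange ℂ)

/-- The complex bilinear extension of the Nijenhuis tensor to `T_xM ⊗ ℂ`. -/
def AlmostComplexStructure.complexNijenhuis [IsManifold 𝓘(ℝ, E) ∞ M] [CompleteSpace E]
    [FiniteDimensional ℝ E] (J : AlmostComplexStructure E M) (x : M) :
    LinearMap.BilinMap ℂ (ComplexTangentSpace E x) (ComplexTangentSpace E x) :=
  LinearMap.BilinMap.baseChange ℂ (J.nijenhuis x).toLinearMap₁₂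

/-- The complex linear extension of a connection on `TM`: for a complex vector field `Z = A + iB`
and `W ∈ T_xM ⊗ ℂ`, the vector `∇_W Z = ∇_W A + i ∇_W B`, complex linear in `W`. -/
def complexCov [IsManifold 𝓘(ℝ, E) ∞ M]
    (cov : CovariantDerivative 𝓘(ℝ, E) E (TangentSpace 𝓘(ℝ, E) : M → Type _))
    (Z : ∀ x : M, ComplexTangentSpace E x) (x : M) :
    ComplexTangentSpace E x →ₗ[ℂ] ComplexTangentSpace E x :=
  (cov (fun y ↦ rePart y (Z y)) x).toLinearMap.baseChange ℂ
    + Complex.I • (cov (fun y ↦ imPart y (Z y)) x).toLinearMap.baseChange ℂ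

/-- The `(0,1)`-part of the connection: `∇''_W Z = ∇_{W^{0,1}} Z`. -/
def cov01 [IsManifold 𝓘(ℝ, E) ∞ M] (J : AlmostComplexStructure E M)
    (cov : CovariantDerivative 𝓘(ℝ, E) E (TangentSpace 𝓘(ℝ, E) : M → Type _))
    (Z : ∀ x : M, ComplexTangentSpace E x) (x : M) :
    ComplexTangentSpace E x →ₗ[ℂ] ComplexTangentSpace E x :=
  complexCov cov Z x ∘ₗ J.proj01 x

/-- `(∇''_W N_J)(X,Y) = ∇''_W (N_J(X,Y)) - N_J(∇''_W X, Y) - N_J(X, ∇''_W Y)` at the point `x`. -/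
def cov01Nijenhuis [IsManifold 𝓘(ℝ, E) ∞ M] [CompleteSpace E] [FiniteDimensional ℝ E]
    (J : AlmostComplexStructure E M)
    (cov : CovariantDerivative 𝓘(ℝ, E) E (TangentSpace 𝓘(ℝ, E) : M → Type _))
    (X Y : ∀ x : M, ComplexTangentSpace E x) (x : M) (W : ComplexTangentSpace E x) :
    ComplexTangentSpace E x :=
  cov01 J cov (fun y ↦ J.complexNijenhuis y (X y) (Y y)) x W
    - J.complexNijenhuis x (cov01 J cov X x W) (Y x)
    - J.complexNijenhuis x (X x) (cov01 J cov Y x W)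

/-- `∇'' N_J = 0`. -/
def Cov01NijenhuisVanishes [IsManifold 𝓘(ℝ, E) ∞ M] [CompleteSpace E] [FiniteDimensional ℝ E]
    (J : AlmostComplexStructure E M)
    (cov : CovariantDerivative 𝓘(ℝ, E) E (TangentSpace 𝓘(ℝ, E) : M → Type _)) : Prop :=
  ∀ (U : Set M) (X Y : ∀ x : M, ComplexTangentSpace E x), IsOpen U →
    SmoothComplexFieldOn X U → SmoothComplexFieldOn Y U →
    ∀ x ∈ U, ∀ W : ComplexTangentSpace E x, cov01Nijenhuis J cov X Y x W = 0

end Complexification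

section Kahler

variable {E : Type*} [NormedAddCommGroup E] [NormedSpace ℝ E]
  {M : Type*} [TopologicalSpace M] [ChartedSpace E M] [IsManifold 𝓘(ℝ, E) ∞ M]

/-- The connection is the Levi-Civita connection of the Riemannian metric `g`: it is compatible
with the metric, `X g(Y,Z) = g(∇_X Y, Z) + g(Y, ∇_X Z)`, and torsion free. -/
structure IsLeviCivita [CompleteSpace E] [FiniteDimensional ℝ E]
    (g : ContMDiffRiemannianMetric 𝓘(ℝ, E) ∞ E (fun x : M ↦ TangentSpace 𝓘(ℝ, E) x))
    (cov : CovariantDerivative 𝓘(ℝ, E) E (TangentSpace 𝓘(ℝ, E) : M → Type _)) : Prop where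
  metric : ∀ (x : M) (X : TangentSpace 𝓘(ℝ, E) x) (Y Z : ∀ x : M, TangentSpace 𝓘(ℝ, E) x),
    MDiffAt (T% Y) x → MDiffAt (T% Z) x →
    mvfderiv 𝓘(ℝ, E) (fun y ↦ g.inner y (Y y) (Z y)) x X
      = g.inner x (cov Y x X) (Z x) + g.inner x (Y x) (cov Z x X)
  torsion_free : cov.torsion = 0

/-- `(M, g, J, κ)` is an almost Kähler manifold: the Riemannian metric `g` is `κ(·, J·)`, and it is
Hermitian, i.e. `J` is `κ`-calibrated. -/
structure IsAlmostKahler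
    (g : ContMDiffRiemannianMetric 𝓘(ℝ, E) ∞ E (fun x : M ↦ TangentSpace 𝓘(ℝ, E) x))
    (J : AlmostComplexStructure E M) (κ : SymplecticForm E M) : Prop where
  metric_eq : ∀ (x : M) (v w : TangentSpace 𝓘(ℝ, E) x),
    g.inner x v w = κ.toFun x v (J.toFun x w)
  hermitian : ∀ (x : M) (v w : TangentSpace 𝓘(ℝ, E) x),
    g.inner x (J.toFun x v) (J.toFun x w) = g.inner x v w

/-- `(M, g, J, κ)` is a Kähler manifold: it is almost Kähler and `J` is integrable. -/
structure IsKahler [CompleteSpace E] [FiniteDimensional ℝ E]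
    (g : ContMDiffRiemannianMetric 𝓘(ℝ, E) ∞ E (fun x : M ↦ TangentSpace 𝓘(ℝ, E) x))
    (J : AlmostComplexStructure E M) (κ : SymplecticForm E M) : Prop where
  isAlmostKahler : IsAlmostKahler g J κ
  isIntegrable : J.IsIntegrable

end Kahler

end

/-!
The proof compares two descriptions of the tensor `A_W X = (∇_W J) X = ∇_W (JX) - J ∇_W X`.

* Since `N_J` and `∇` are real, the real part of `∇''N_J = 0` on real arguments says that `N_J` is
  parallel. As `N_J` is alternating and `J`-antilinear, the field `N_J(JX, X)` vanishes identically,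
  and differentiating this relation gives `N_J(A_W X, X) = 0`
  (`AlmostComplexStructure.nijenhuis_covDeriv_self`).
* On an almost Kähler manifold, torsion-freeness, metric compatibility and `dκ = 0` give
  `g(N_J(Y, Z), JW) = 2 g(A_W Y, Z)` (`IsAlmostKahler.inner_nijenhuis`).

Put `Y = X` and `Z = A_W X` in the second identity: by the first one,
`2 |A_W X|² = g(N_J(X, A_W X), JW) = 0`. So `A = 0`, and by the second identity `N_J` is orthogonal
to all vectors `JW`, that is, `N_J = 0`.
-/

/-! ### Smooth local vector fields -/

section Fields

variable {E : Type*} [NormedAddCommGroup E] [NormedSpace ℝ E]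
  {M : Type*} [TopologicalSpace M] [ChartedSpace E M] [IsManifold 𝓘(ℝ, E) ∞ M]

theorem SmoothFieldOn.mdifferentiableAt {X : ∀ x : M, TangentSpace 𝓘(ℝ, E) x} {U : Set M}
    (hX : SmoothFieldOn X U) (hU : IsOpen U) {x : M} (hx : x ∈ U) : MDiffAt (T% X) x :=
  ((hX x hx).contMDiffAt (hU.mem_nhds hx)).mdifferentiableAt (by simp)

theorem SmoothFieldOn.mono {X : ∀ x : M, TangentSpace 𝓘(ℝ, E) x} {U V : Set M}
    (hX : SmoothFieldOn X U) (hVU : V ⊆ U) : SmoothFieldOn X V :=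
  ContMDiffOn.mono hX hVU

theorem smoothFieldOn_zero (U : Set M) :
    SmoothFieldOn (fun x ↦ (0 : TangentSpace 𝓘(ℝ, E) x)) U :=
  (contMDiff_zeroSection ℝ (TangentSpace 𝓘(ℝ, E) : M → Type _)).contMDiffOn

theorem exists_smoothFieldOn_eq {x : M} (v : TangentSpace 𝓘(ℝ, E) x) :
    ∃ (U : Set M) (X : ∀ x : M, TangentSpace 𝓘(ℝ, E) x),
      IsOpen U ∧ x ∈ U ∧ SmoothFieldOn X U ∧ X x = v := by
  obtain ⟨s, hs, h⟩ := FiberBundle.exists_contMDiffOn_extend (k := ∞) 𝓘(ℝ, E) E v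
  exact ⟨interior s, FiberBundle.extend E v, isOpen_interior, mem_interior_iff_mem_nhds.2 hs,
    h.mono interior_subset, by simp⟩

theorem CovariantDerivative.neg_field
    (cov : CovariantDerivative 𝓘(ℝ, E) E (TangentSpace 𝓘(ℝ, E) : M → Type _))
    {X : ∀ x : M, TangentSpace 𝓘(ℝ, E) x} {x : M} (hX : MDiffAt (T% X) x) :
    cov (-X) x = -cov X x := by
  simpa using cov.isCovariantDerivativeOnUniv.smul_const (-1 : ℝ) hX

theorem CovariantDerivative.mlieBracket_eq [CompleteSpace E] [FiniteDimensional ℝ E]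
    (cov : CovariantDerivative 𝓘(ℝ, E) E (TangentSpace 𝓘(ℝ, E) : M → Type _))
    (hcov : cov.torsion = 0) {X Y : ∀ x : M, TangentSpace 𝓘(ℝ, E) x} {x : M}
    (hX : MDiffAt (T% X) x) (hY : MDiffAt (T% Y) x) :
    VectorField.mlieBracket 𝓘(ℝ, E) X Y x = cov Y x (X x) - cov X x (Y x) :=
  (cov.torsion_eq_zero_iff.1 hcov hX hY).symm

end Fields

namespace AlmostComplexStructure

variable {E : Type*} [NormedAddCommGroup E] [NormedSpace ℝ E]
  {M : Type*} [TopologicalSpace M] [ChartedSpace E M] [IsManifold 𝓘(ℝ, E) ∞ M]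
  (J : AlmostComplexStructure E M)

@[simp]
theorem onField_apply (X : ∀ x : M, TangentSpace 𝓘(ℝ, E) x) (x : M) :
    J.onField X x = J.toFun x (X x) := rfl

theorem onField_onField (X : ∀ x : M, TangentSpace 𝓘(ℝ, E) x) :
    J.onField (J.onField X) = -X :=
  funext fun x ↦ J.sq_eq_neg x (X x)

theorem smoothFieldOn_onField {X : ∀ x : M, TangentSpace 𝓘(ℝ, E) x} {U : Set M}
    (hX : SmoothFieldOn X U) : SmoothFieldOn (J.onField X) U :=
  ContMDiffOn.clm_bundle_apply J.smooth.contMDiffOn hX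

/-! ### Algebraic symmetries of the Nijenhuis tensor -/

section Nijenhuis

variable [CompleteSpace E] [FiniteDimensional ℝ E]

theorem nijenhuis_self (x : M) (v : TangentSpace 𝓘(ℝ, E) x) : J.nijenhuis x v v = 0 := by
  obtain ⟨U, X, hU, hx, hX, rfl⟩ := exists_smoothFieldOn_eq v
  have hX' := hX.mdifferentiableAt hU hx
  rw [J.nijenhuis_apply hX' hX']
  have h : (2 : ℝ) • J.nijenhuisField X X x = 0 := by
    rw [two_smul]
    exact add_eq_zero_iff_eq_neg.2 (J.nijenhuisField_swap X X x)
  exact (smul_eq_zero.1 h).resolve_left two_ne_zero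

theorem nijenhuis_swap (x : M) (v w : TangentSpace 𝓘(ℝ, E) x) :
    J.nijenhuis x v w = -J.nijenhuis x w v := by
  have h := J.nijenhuis_self x (v + w)
  simp only [map_add, add_apply, nijenhuis_self, zero_add, add_zero] at h
  exact eq_neg_of_add_eq_zero_right h

theorem nijenhuis_map_left (x : M) (v w : TangentSpace 𝓘(ℝ, E) x) :
    J.nijenhuis x (J.toFun x v) w = -J.toFun x (J.nijenhuis x v w) := by
  obtain ⟨U, X, hU, hx, hX, rfl⟩ := exists_smoothFieldOn_eq v
  obtain ⟨V, Y, hV, hx', hY, rfl⟩ := exists_smoothFieldOn_eq w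
  have hX' := hX.mdifferentiableAt hU hx
  have hY' := hY.mdifferentiableAt hV hx'
  rw [← J.onField_apply X, J.nijenhuis_apply (J.mdifferentiableAt_onField hX') hY',
    J.nijenhuis_apply hX' hY']
  have hneg : ∀ Z : ∀ x : M, TangentSpace 𝓘(ℝ, E) x,
      VectorField.mlieBracket 𝓘(ℝ, E) (-X) Z x = -VectorField.mlieBracket 𝓘(ℝ, E) X Z x := by
    intro Z
    simpa using VectorField.mlieBracket_const_smul_left (W := Z) (c := (-1 : ℝ)) hX'
  simp only [nijenhuisField, onField_onField, hneg, map_sub, map_neg, J.sq_eq_neg]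
  abel

theorem nijenhuis_map_self (x : M) (v : TangentSpace 𝓘(ℝ, E) x) :
    J.nijenhuis x (J.toFun x v) v = 0 := by
  rw [nijenhuis_map_left, nijenhuis_self, map_zero, neg_zero]

end Nijenhuis

/-! ### The covariant derivative of the almost complex structure -/

variable (cov : CovariantDerivative 𝓘(ℝ, E) E (TangentSpace 𝓘(ℝ, E) : M → Type _))

/-- The vector `(∇_v J) X = ∇_v (JX) - J ∇_v X` at `x`. The argument `X` is kept as a vector field,
so that no appeal to tensoriality is needed. -/
noncomputable def covDeriv (X : ∀ x : M, TangentSpace 𝓘(ℝ, E) x) (x : M)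
    (v : TangentSpace 𝓘(ℝ, E) x) : TangentSpace 𝓘(ℝ, E) x :=
  cov (J.onField X) x v - J.toFun x (cov X x v)

theorem covDeriv_onField {X : ∀ x : M, TangentSpace 𝓘(ℝ, E) x} {x : M} (hX : MDiffAt (T% X) x)
    (v : TangentSpace 𝓘(ℝ, E) x) :
    J.covDeriv cov (J.onField X) x v = -J.toFun x (J.covDeriv cov X x v) := by
  simp only [covDeriv, onField_onField, cov.neg_field hX, map_sub, J.sq_eq_neg,
    neg_apply]
  abel

theorem nijenhuisField_eq_covDeriv [CompleteSpace E] [FiniteDimensional ℝ E]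
    (hcov : cov.torsion = 0) {X Y : ∀ x : M, TangentSpace 𝓘(ℝ, E) x} {x : M}
    (hX : MDiffAt (T% X) x) (hY : MDiffAt (T% Y) x) :
    J.nijenhuisField X Y x =
      J.covDeriv cov Y x (J.toFun x (X x)) - J.covDeriv cov X x (J.toFun x (Y x))
        + J.toFun x (J.covDeriv cov X x (Y x)) - J.toFun x (J.covDeriv cov Y x (X x)) := by
  have hJX := J.mdifferentiableAt_onField hX
  have hJY := J.mdifferentiableAt_onField hY
  have ht {X Y : ∀ x : M, TangentSpace 𝓘(ℝ, E) x} (hX : MDiffAt (T% X) x)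
      (hY : MDiffAt (T% Y) x) := cov.mlieBracket_eq hcov hX hY
  simp only [nijenhuisField, ht hX hY, ht hJX hY, ht hX hJY, ht hJX hJY, covDeriv,
    onField_apply, map_sub, J.sq_eq_neg]
  abel

end AlmostComplexStructure

/-! ### The Nijenhuis tensor and `∇J` on an almost Kähler manifold -/

namespace IsAlmostKahler

variable {E : Type*} [NormedAddCommGroup E] [NormedSpace ℝ E]
  {M : Type*} [TopologicalSpace M] [ChartedSpace E M] [IsManifold 𝓘(ℝ, E) ∞ M]
  {g : ContMDiffRiemannianMetric 𝓘(ℝ, E) ∞ E (fun x : M ↦ TangentSpace 𝓘(ℝ, E) x)}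
  {J : AlmostComplexStructure E M} {κ : SymplecticForm E M}

theorem inner_map_left (h : IsAlmostKahler g J κ) (x : M) (v w : TangentSpace 𝓘(ℝ, E) x) :
    g.inner x (J.toFun x v) w = -g.inner x v (J.toFun x w) := by
  rw [← h.hermitian x v (J.toFun x w), J.sq_eq_neg, map_neg, neg_neg]

theorem form_eq (h : IsAlmostKahler g J κ) (x : M) (v w : TangentSpace 𝓘(ℝ, E) x) :
    κ.toFun x v w = g.inner x (J.toFun x v) w := by
  rw [h.inner_map_left, h.metric_eq, J.sq_eq_neg, map_neg, neg_neg]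

variable [CompleteSpace E] [FiniteDimensional ℝ E]
  {cov : CovariantDerivative 𝓘(ℝ, E) E (TangentSpace 𝓘(ℝ, E) : M → Type _)}

theorem inner_covDeriv_swap (h : IsAlmostKahler g J κ) (hcov : IsLeviCivita g cov)
    {X Y : ∀ x : M, TangentSpace 𝓘(ℝ, E) x} {x : M}
    (hX : MDiffAt (T% X) x) (hY : MDiffAt (T% Y) x) (v : TangentSpace 𝓘(ℝ, E) x) :
    g.inner x (J.covDeriv cov X x v) (Y x) = -g.inner x (J.covDeriv cov Y x v) (X x) := by
  have h1 := hcov.metric x v _ _ (J.mdifferentiableAt_onField hX) hY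
  have h2 := hcov.metric x v _ _ hX (J.mdifferentiableAt_onField hY)
  have h3 : mvfderiv 𝓘(ℝ, E) (fun y ↦ g.inner y (J.onField X y) (Y y)) x v
      = -mvfderiv 𝓘(ℝ, E) (fun y ↦ g.inner y (X y) (J.onField Y y)) x v := by
    rw [← neg_apply, ← mvfderiv_neg]
    congr 2
    funext y
    exact h.inner_map_left y (X y) (Y y)
  rw [h1, h2] at h3
  simp only [AlmostComplexStructure.onField_apply, h.inner_map_left] at h3
  simp only [AlmostComplexStructure.covDeriv, map_sub, sub_apply,
    h.inner_map_left, g.symm x _ (X x)]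
  have h4 := h.inner_map_left x (X x) (cov Y x v)
  rw [g.symm] at h4
  linarith

theorem mvfderiv_form (h : IsAlmostKahler g J κ) (hcov : IsLeviCivita g cov)
    {X Y : ∀ x : M, TangentSpace 𝓘(ℝ, E) x} {x : M}
    (hX : MDiffAt (T% X) x) (hY : MDiffAt (T% Y) x) (v : TangentSpace 𝓘(ℝ, E) x) :
    mvfderiv 𝓘(ℝ, E) (fun y ↦ κ.toFun y (X y) (Y y)) x v =
      g.inner x (J.covDeriv cov X x v) (Y x) + κ.toFun x (cov X x v) (Y x)
        + κ.toFun x (X x) (cov Y x v) := by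
  simp only [h.form_eq, AlmostComplexStructure.covDeriv]
  refine (hcov.metric x v _ _ (J.mdifferentiableAt_onField hX) hY).trans ?_
  simp

/-- For a torsion-free metric connection, `dκ(X,Y,Z)` is the cyclic sum of `g((∇_X J)Y, Z)`. -/
theorem cyclic_sum_inner_covDeriv (h : IsAlmostKahler g J κ) (hcov : IsLeviCivita g cov)
    {X Y Z : ∀ x : M, TangentSpace 𝓘(ℝ, E) x} {U : Set M} (hU : IsOpen U)
    (hX : SmoothFieldOn X U) (hY : SmoothFieldOn Y U) (hZ : SmoothFieldOn Z U)
    {x : M} (hx : x ∈ U) :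
    g.inner x (J.covDeriv cov Y x (X x)) (Z x) + g.inner x (J.covDeriv cov Z x (Y x)) (X x)
      + g.inner x (J.covDeriv cov X x (Z x)) (Y x) = 0 := by
  have hd := κ.closed U X Y Z hU hX hY hZ x hx
  have hX' := hX.mdifferentiableAt hU hx
  have hY' := hY.mdifferentiableAt hU hx
  have hZ' := hZ.mdifferentiableAt hU hx
  have ht {X Y : ∀ x : M, TangentSpace 𝓘(ℝ, E) x} (hX : MDiffAt (T% X) x)
      (hY : MDiffAt (T% Y) x) := cov.mlieBracket_eq hcov.torsion_free hX hY
  have hκ : ∀ v w, κ.toFun x v w = -κ.toFun x w v := by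
    intro v w
    have := κ.alternating x (v + w)
    simp only [map_add, add_apply, κ.alternating] at this
    linarith
  rw [extDerivTwoForm, h.mvfderiv_form hcov hY' hZ', h.mvfderiv_form hcov hX' hZ',
    h.mvfderiv_form hcov hX' hY', ht hX' hY', ht hX' hZ', ht hY' hZ'] at hd
  simp only [map_sub, sub_apply] at hd
  have h1 := hκ (X x) (cov Y x (Z x))
  have h2 := hκ (X x) (cov Z x (Y x))
  have h3 := hκ (Y x) (cov Z x (X x))
  have h4 := h.inner_covDeriv_swap hcov hX' hZ' (Y x)
  linarith

/-- On an almost Kähler manifold, `g(N_J(Y, Z), JX) = 2 g((∇_X J) Y, Z)`. -/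
theorem inner_nijenhuis (h : IsAlmostKahler g J κ) (hcov : IsLeviCivita g cov)
    {X Y Z : ∀ x : M, TangentSpace 𝓘(ℝ, E) x} {U : Set M} (hU : IsOpen U)
    (hX : SmoothFieldOn X U) (hY : SmoothFieldOn Y U) (hZ : SmoothFieldOn Z U)
    {x : M} (hx : x ∈ U) :
    g.inner x (J.nijenhuis x (Y x) (Z x)) (J.toFun x (X x)) =
      2 * g.inner x (J.covDeriv cov Y x (X x)) (Z x) := by
  have hX' := hX.mdifferentiableAt hU hx
  have hY' := hY.mdifferentiableAt hU hx
  have hZ' := hZ.mdifferentiableAt hU hx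
  have hJX := J.smoothFieldOn_onField hX
  have hJY := J.smoothFieldOn_onField hY
  have hJZ := J.smoothFieldOn_onField hZ
  have hJX' := hJX.mdifferentiableAt hU hx
  have hJY' := hJY.mdifferentiableAt hU hx
  have hJZ' := hJZ.mdifferentiableAt hU hx
  -- Both cyclic sums are needed: `g((∇_X J)Y, Z)` arises once from `(X, Y, Z)` and once from
  -- `(X, JY, JZ)`.
  have c1 := h.cyclic_sum_inner_covDeriv hcov hU hX hY hZ hx
  have c2 := h.cyclic_sum_inner_covDeriv hcov hU hX hJY hJZ hx
  rw [J.nijenhuis_apply hY' hZ', J.nijenhuisField_eq_covDeriv cov hcov.torsion_free hY' hZ']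
  have s1 := h.inner_covDeriv_swap hcov hX' hY' (J.toFun x (Z x))
  have s2 := h.inner_covDeriv_swap hcov hX' hY' (Z x)
  have s3 := h.inner_covDeriv_swap hcov hX' hJY' (J.toFun x (Z x))
  simp only [AlmostComplexStructure.onField_apply,
    J.covDeriv_onField cov hY', J.covDeriv_onField cov hZ', map_neg, map_add, map_sub,
    neg_apply, add_apply, sub_apply,
    h.inner_map_left, J.sq_eq_neg, neg_neg] at c1 c2 s1 s2 s3 ⊢
  linarith

end IsAlmostKahler

/-! ### Real vector fields in the complexified tangent bundle -/

section Real

variable {E : Type*} [NormedAddCommGroup E] [NormedSpace ℝ E]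
  {M : Type*} [TopologicalSpace M] [ChartedSpace E M]

@[simp]
theorem rePart_tmul (x : M) (z : ℂ) (v : TangentSpace 𝓘(ℝ, E) x) :
    rePart x (z ⊗ₜ[ℝ] v : ComplexTangentSpace E x) = z.re • v := by
  simp [rePart]

@[simp]
theorem imPart_tmul (x : M) (z : ℂ) (v : TangentSpace 𝓘(ℝ, E) x) :
    imPart x (z ⊗ₜ[ℝ] v : ComplexTangentSpace E x) = z.im • v := by
  simp [imPart]

variable [IsManifold 𝓘(ℝ, E) ∞ M]

theorem SmoothFieldOn.complex {X : ∀ x : M, TangentSpace 𝓘(ℝ, E) x} {U : Set M}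
    (hX : SmoothFieldOn X U) :
    SmoothComplexFieldOn (fun x ↦ ((1 : ℂ) ⊗ₜ[ℝ] X x : ComplexTangentSpace E x)) U := by
  constructor
  · simpa using hX
  · simpa using smoothFieldOn_zero U

/-- The `(0,1)`-derivative of a real field in a real direction, with the factor `1 / 2` coming from
the projection `W ↦ W^{0,1}`. -/
theorem cov01_one_tmul (J : AlmostComplexStructure E M)
    (cov : CovariantDerivative 𝓘(ℝ, E) E (TangentSpace 𝓘(ℝ, E) : M → Type _))
    (X : ∀ x : M, TangentSpace 𝓘(ℝ, E) x) (x : M) (w : TangentSpace 𝓘(ℝ, E) x) :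
    cov01 J cov (fun y ↦ ((1 : ℂ) ⊗ₜ[ℝ] X y : ComplexTangentSpace E y)) x (1 ⊗ₜ[ℝ] w) =
      (1 / 2 : ℂ) ⊗ₜ[ℝ] cov X x w + (1 / 2 * Complex.I) ⊗ₜ[ℝ] cov X x (J.toFun x w) := by
  have h0 : cov (fun y : M ↦ (0 : TangentSpace 𝓘(ℝ, E) y)) x = 0 :=
    congrFun cov.zero x
  simp [cov01, complexCov, AlmostComplexStructure.proj01, h0, TensorProduct.smul_tmul']

variable [CompleteSpace E] [FiniteDimensional ℝ E]

@[simp]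
theorem AlmostComplexStructure.complexNijenhuis_tmul (J : AlmostComplexStructure E M) (x : M)
    (a b : ℂ) (v w : TangentSpace 𝓘(ℝ, E) x) :
    J.complexNijenhuis x (a ⊗ₜ[ℝ] v) (b ⊗ₜ[ℝ] w) = (a * b) ⊗ₜ[ℝ] J.nijenhuis x v w := by
  simp [complexNijenhuis]

/-- If `∇''N_J = 0`, then `N_J` is parallel. -/
theorem Cov01NijenhuisVanishes.cov_nijenhuis {J : AlmostComplexStructure E M}
    {cov : CovariantDerivative 𝓘(ℝ, E) E (TangentSpace 𝓘(ℝ, E) : M → Type _)}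
    (hN : Cov01NijenhuisVanishes J cov) {X Y : ∀ x : M, TangentSpace 𝓘(ℝ, E) x} {U : Set M}
    (hU : IsOpen U) (hX : SmoothFieldOn X U) (hY : SmoothFieldOn Y U) {x : M} (hx : x ∈ U)
    (w : TangentSpace 𝓘(ℝ, E) x) :
    cov (fun y ↦ J.nijenhuis y (X y) (Y y)) x w =
      J.nijenhuis x (cov X x w) (Y x) + J.nijenhuis x (X x) (cov Y x w) := by
  have h := congrArg (rePart x) (hN U _ _ hU hX.complex hY.complex x hx (1 ⊗ₜ[ℝ] w))
  simp only [cov01Nijenhuis, AlmostComplexStructure.complexNijenhuis_tmul, mul_one,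
    cov01_one_tmul, map_add, map_sub, LinearMap.add_apply, rePart_tmul, one_mul, map_zero] at h
  -- The terms `∇_{JW}` are purely imaginary and drop out.
  norm_num [sub_sub, ← smul_add, ← smul_sub] at h
  exact sub_eq_zero.1 h

/-- If `N_J` is parallel, then `N_J((∇_w J) X, X) = 0`: the field `N_J(JX, X)` vanishes identically,
and the terms of its derivative that involve `∇_w X` cancel. -/
theorem AlmostComplexStructure.nijenhuis_covDeriv_self {J : AlmostComplexStructure E M}
    {cov : CovariantDerivative 𝓘(ℝ, E) E (TangentSpace 𝓘(ℝ, E) : M → Type _)}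
    (hN : Cov01NijenhuisVanishes J cov) {X : ∀ x : M, TangentSpace 𝓘(ℝ, E) x} {U : Set M}
    (hU : IsOpen U) (hX : SmoothFieldOn X U) {x : M} (hx : x ∈ U)
    (w : TangentSpace 𝓘(ℝ, E) x) :
    J.nijenhuis x (J.covDeriv cov X x w) (X x) = 0 := by
  have h := hN.cov_nijenhuis hU (J.smoothFieldOn_onField hX) hX hx w
  have h0 : (fun y ↦ J.nijenhuis y (J.onField X y) (X y)) = 0 :=
    funext fun y ↦ J.nijenhuis_map_self y (X y)
  rw [h0, cov.zero] at h
  simp only [onField_apply, J.nijenhuis_map_left x (X x), J.nijenhuis_swap x (X x), map_neg,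
    neg_neg] at h
  rw [covDeriv, map_sub, sub_apply, nijenhuis_map_left, sub_neg_eq_add, ← h]
  rfl

end Real

theorem IsAlmostKahler.isIntegrable_of_cov01Nijenhuis
    {E : Type*} [NormedAddCommGroup E] [NormedSpace ℝ E] [FiniteDimensional ℝ E] [CompleteSpace E]
    {M : Type*} [TopologicalSpace M] [ChartedSpace E M] [IsManifold 𝓘(ℝ, E) ∞ M]
    {g : ContMDiffRiemannianMetric 𝓘(ℝ, E) ∞ E (fun x : M ↦ TangentSpace 𝓘(ℝ, E) x)}
    {J : AlmostComplexStructure E M} {κ : SymplecticForm E M} (hJκ : IsAlmostKahler g J κ)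
    {cov : CovariantDerivative 𝓘(ℝ, E) E (TangentSpace 𝓘(ℝ, E) : M → Type _)}
    (hcov : IsLeviCivita g cov) (hN : Cov01NijenhuisVanishes J cov) : J.IsIntegrable := by
  have eq_zero : ∀ (x : M) (v : TangentSpace 𝓘(ℝ, E) x), g.inner x v v = 0 → v = 0 := by
    intro x v hv
    by_contra h
    exact (g.pos x v h).ne' hv
  intro x
  ext v u
  obtain ⟨U, X, hU, hxU, hX, rfl⟩ := exists_smoothFieldOn_eq v
  have key : ∀ w z : TangentSpace 𝓘(ℝ, E) x,
      g.inner x (J.nijenhuis x (X x) z) (J.toFun x w) =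
        2 * g.inner x (J.covDeriv cov X x w) z := by
    intro w z
    obtain ⟨V, W, hV, hxV, hW, rfl⟩ := exists_smoothFieldOn_eq w
    obtain ⟨V', Z, hV', hxV', hZ, rfl⟩ := exists_smoothFieldOn_eq z
    exact hJκ.inner_nijenhuis hcov (hU.inter (hV.inter hV'))
      (hW.mono fun _ h ↦ h.2.1) (hX.mono fun _ h ↦ h.1) (hZ.mono fun _ h ↦ h.2.2)
      ⟨hxU, hxV, hxV'⟩
  have hA : ∀ w, J.covDeriv cov X x w = 0 := by
    intro w
    apply eq_zero
    have h := key w (J.covDeriv cov X x w)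
    rw [J.nijenhuis_swap, J.nijenhuis_covDeriv_self hN hU hX hxU] at h
    simpa using h.symm
  -- Every vector is of the form `Jw`; here `w = -J N_J(X, u)`.
  have h := key (-J.toFun x (J.nijenhuis x (X x) u)) u
  rw [hA, map_neg, J.sq_eq_neg, neg_neg, map_zero] at h
  exact eq_zero x _ (by simpa using h)

theorem theorem3p2 {E : Type*} [NormedAddCommGroup E] [NormedSpace ℝ E] [FiniteDimensional ℝ E]
    [CompleteSpace E]
    {M : Type*} [TopologicalSpace M] [T2Space M] [SecondCountableTopology M]
    [ChartedSpace E M] [IsManifold 𝓘(ℝ, E) ∞ M]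
    (g : ContMDiffRiemannianMetric 𝓘(ℝ, E) ∞ E (fun x : M ↦ TangentSpace 𝓘(ℝ, E) x))
    (J : AlmostComplexStructure E M) (κ : SymplecticForm E M)
    (hJκ : IsAlmostKahler g J κ)
    (cov : CovariantDerivative 𝓘(ℝ, E) E (TangentSpace 𝓘(ℝ, E) : M → Type _))
    (hcov : IsLeviCivita g cov)
    (hN : Cov01NijenhuisVanishes J cov) :
    J.IsIntegrable ∧ IsKahler g J κ := by
  have hJ := hJκ.isIntegrable_of_cov01Nijenhuis hcov hN
  exact ⟨hJ, hJκ, hJ⟩
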